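/- Let $n,m\ge 0$ be integers, $\rho\ge 0$, $B,D\in\mathbb{R}^{n\times m}$, and let $R\in\mathbb{R}^{m\times m}$ be symmetric (not necessarily definite). Consider the multiple-integrator mean field game with agents $dx_i=Bu_i\,dt+Du_i\,dW_i$ and costs $\mathbb{E}\int_0^\infty e^{-\rho t}\{\|x_i-x^{(N)}\|^2+u_i^TRu_i\}\,dt$, where $x^{(N)}$ is the average of the states, that is, the linear-quadratic model with $A=0$, $C=0$, $Q=I$. Let $P\in\mathbb{R}^{n\times n}$ be a symmetric solution of the associated algebraic Riccati equation $$\rho P=I-PB(R+D^TPD)^{-1}B^TP,$$ with $R+D^TPD$ invertible (for instance, the stabilizing solution, if it exists). Put $\bar A=-B(R+D^TPD)^{-1}B^TP$. Then for every $\bar x_0\in\mathbb{R}^n$ the consistency equations $$\rho s(t)=\frac{ds}{dt}(t)+\bar A^Ts(t)-\bar x(t),\qquad \frac{d\bar x}{dt}(t)=\bar A\bar x(t)-B(R+D^TPD)^{-1}B^Ts(t),\qquad t\ge 0,$$ with $\bar x(0)=\bar x_0$ and $s(0)$ not prescribed, have exactly one solution $(s,\bar x)$ that is bounded on $[0,\infty)$,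 namely the constant $$(s(t),\bar x(t))\equiv(-P\bar x_0,\bar x_0),\qquad t\ge 0.$$ -/

import Mathlib

open scoped Matrix

namespace MeanFieldLQ

variable {n m : ℕ}

/-- The weight `R + Dᵀ P D` of the control in the Riccati equation. -/
def controlWeight (D : Matrix (Fin n) (Fin m) ℝ) (R : Matrix (Fin m) (Fin m) ℝ)
    (P : Matrix (Fin n) (Fin n) ℝ) : Matrix (Fin m) (Fin m) ℝ :=
  R + Dᵀ * P * D

/-- `P` is a symmetric solution, with `R + Dᵀ P D` invertible, of the algebraic Riccati equation
`ρ P = Aᵀ P + P A + Cᵀ P C + Q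
  - (Bᵀ P + Dᵀ P C)ᵀ (R + Dᵀ P D)⁻¹ (Bᵀ P + Dᵀ P C)`. -/
structure IsRiccatiSolution (ρ : ℝ) (A : Matrix (Fin n) (Fin n) ℝ) (B : Matrix (Fin n) (Fin m) ℝ)
    (C : Matrix (Fin n) (Fin n) ℝ) (D : Matrix (Fin n) (Fin m) ℝ)
    (Q : Matrix (Fin n) (Fin n) ℝ) (R : Matrix (Fin m) (Fin m) ℝ)
    (P : Matrix (Fin n) (Fin n) ℝ) : Prop where
  symm : P.IsSymm
  isUnit : IsUnit (controlWeight D R P)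
  riccati : ρ • P = Aᵀ * P + P * A + Cᵀ * P * C + Q
    - (Bᵀ * P + Dᵀ * P * C)ᵀ * (controlWeight D R P)⁻¹ * (Bᵀ * P + Dᵀ * P * C)

/-- The closed-loop drift matrix `Ā = A - B (R + Dᵀ P D)⁻¹ (Bᵀ P + Dᵀ P C)`. -/
noncomputable def closedLoop (A : Matrix (Fin n) (Fin n) ℝ) (B : Matrix (Fin n) (Fin m) ℝ)
    (C : Matrix (Fin n) (Fin n) ℝ) (D : Matrix (Fin n) (Fin m) ℝ)
    (R : Matrix (Fin m) (Fin m) ℝ) (P : Matrix (Fin n) (Fin n) ℝ) : Matrix (Fin n) (Fin n) ℝ :=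
  A - B * (controlWeight D R P)⁻¹ * (Bᵀ * P + Dᵀ * P * C)

/-- `(s, x)` solves on `[0, ∞)` the consistency equations of the mean field approximation for
uniform agents,
`ρ s = ds/dt + Āᵀ s - Q x`,  `dx/dt = Ā x - B (R + Dᵀ P D)⁻¹ Bᵀ s`,  `x(0) = x₀`;
the initial value of `s` is not prescribed. The derivatives at `0` are one-sided. -/
structure SolvesConsistency (ρ : ℝ) (A : Matrix (Fin n) (Fin n) ℝ) (B : Matrix (Fin n) (Fin m) ℝ)
    (C : Matrix (Fin n) (Fin n) ℝ) (D : Matrix (Fin n) (Fin m) ℝ)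
    (Q : Matrix (Fin n) (Fin n) ℝ) (R : Matrix (Fin m) (Fin m) ℝ)
    (P : Matrix (Fin n) (Fin n) ℝ) (x₀ : Fin n → ℝ) (s x : ℝ → Fin n → ℝ) : Prop where
  init : x 0 = x₀
  adjoint : ∀ t : ℝ, 0 ≤ t →
    HasDerivWithinAt s (ρ • s t - (closedLoop A B C D R P)ᵀ *ᵥ s t + Q *ᵥ x t) (Set.Ici 0) t
  state : ∀ t : ℝ, 0 ≤ t →
    HasDerivWithinAt x
      (closedLoop A B C D R P *ᵥ x t - (B * (controlWeight D R P)⁻¹ * Bᵀ) *ᵥ s t) (Set.Ici 0) t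

/-- `f` is bounded on `[0, ∞)`. -/
def BoundedOnHalfLine (f : ℝ → Fin n → ℝ) : Prop :=
  ∃ K : ℝ, ∀ t : ℝ, 0 ≤ t → ‖f t‖ ≤ K

/-- `(s, x)` is a bounded solution of the consistency equations for the multiple-integrator model
`dxᵢ = B uᵢ dt + D uᵢ dWᵢ` with running cost `‖xᵢ - x⁽ᴺ⁾‖² + ‖uᵢ‖²_R`, that is, for
`A = 0`, `C = 0`, `Q = I`. -/
def IsBoundedIntegratorSolution (ρ : ℝ) (B D : Matrix (Fin n) (Fin m) ℝ)
    (R : Matrix (Fin m) (Fin m) ℝ) (P : Matrix (Fin n) (Fin n) ℝ) (x₀ : Fin n → ℝ)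
    (s x : ℝ → Fin n → ℝ) : Prop :=
  SolvesConsistency ρ 0 B 0 D 1 R P x₀ s x ∧ BoundedOnHalfLine s ∧ BoundedOnHalfLine x

end MeanFieldLQ

/-!
Write `M = B (R + Dᵀ P D)⁻¹ Bᵀ`. For `A = 0`, `C = 0`, `Q = 1` the Riccati equation reads
`P (ρ + M P) = 1`, so `P` is invertible with inverse `N = ρ + M P`, and every coefficient of the
consistency equations is a polynomial in `N`: `Ā = ρ - N` and `M = (N - ρ) N`
(`IsRiccatiSolution.exists_inverse`). The variable `y = x + N s` then decouples the system into
`s' = y`, `y' = ρ y`. Hence `y = exp (ρ t) y(0)`, and as `ρ ≥ 0`, each coordinate of `s` grows at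
least linearly unless `y(0) = 0` (`eq_zero_of_bounded_antiderivative`). A bounded solution therefore
has `y = 0`, so that `s` is constant and `x = -N s`, that is, `s = -P x`, is constant too.
-/

namespace MeanFieldLQ

variable {n m : ℕ}

/-- For the multiple-integrator model, `P` has a symmetric inverse `N`, through which the
coefficients of the consistency equations are expressed. -/
theorem IsRiccatiSolution.exists_inverse {ρ : ℝ} {B D : Matrix (Fin n) (Fin m) ℝ}
    {R : Matrix (Fin m) (Fin m) ℝ} {P : Matrix (Fin n) (Fin n) ℝ}
    (hP : IsRiccatiSolution ρ 0 B 0 D 1 R P) :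
    ∃ N : Matrix (Fin n) (Fin n) ℝ, P * N = 1 ∧ N * P = 1 ∧
      closedLoop 0 B 0 D R P = ρ • 1 - N ∧ (closedLoop 0 B 0 D R P)ᵀ = ρ • 1 - N ∧
      B * (controlWeight D R P)⁻¹ * Bᵀ = (N - ρ • 1) * N := by
  obtain ⟨hs, -, hr⟩ := hP
  set M := B * (controlWeight D R P)⁻¹ * Bᵀ with hM
  have hr' : ρ • P = 1 - P * M * P := by
    rw [hr, hM]
    simp [Matrix.transpose_mul, hs.eq, Matrix.mul_assoc]
  have hPN : P * (ρ • 1 + M * P) = 1 := by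
    rw [Matrix.mul_add, Matrix.mul_smul, Matrix.mul_one, hr', ← Matrix.mul_assoc P M P,
      sub_add_cancel]
  have hNP := mul_eq_one_comm.mp hPN
  have hA : closedLoop 0 B 0 D R P = ρ • 1 - (ρ • 1 + M * P) := by
    simp [closedLoop, hM, Matrix.mul_assoc]
  have hN : (ρ • 1 + M * P)ᵀ = ρ • 1 + M * P := by
    refine left_inv_eq_right_inv (a := P) ?_ hPN
    have := congrArg Matrix.transpose hPN
    rwa [Matrix.transpose_mul, hs.eq, Matrix.transpose_one] at this
  refine ⟨ρ • 1 + M * P, hPN, hNP, hA, ?_, ?_⟩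
  · rw [hA, Matrix.transpose_sub, hN]
    simp
  · rw [add_sub_cancel_left, Matrix.mul_assoc, hPN, Matrix.mul_one]

/-- If `y' = ρ y` with `ρ ≥ 0` on `[0, ∞)` and `y` has a bounded antiderivative there, then
`y = 0`. -/
theorem eq_zero_of_bounded_antiderivative {ρ : ℝ} (hρ : 0 ≤ ρ) {σ y : ℝ → ℝ}
    (hσ : ∀ t, 0 ≤ t → HasDerivWithinAt σ (y t) (Set.Ici 0) t)
    (hy : ∀ t, 0 ≤ t → HasDerivWithinAt y (ρ * y t) (Set.Ici 0) t)
    {K : ℝ} (hK : ∀ t, 0 ≤ t → |σ t| ≤ K) {t : ℝ} (ht : 0 ≤ t) : y t = 0 := by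
  have hexp : ∀ t, 0 ≤ t → y t = Real.exp (ρ * t) * y 0 := by
    have hd : ∀ t, 0 ≤ t →
        HasDerivWithinAt (fun t => Real.exp (-ρ * t) * y t) 0 (Set.Ici 0) t := by
      intro t ht
      have h := (((hasDerivAt_id t).const_mul (-ρ)).exp.hasDerivWithinAt (s := Set.Ici 0)).mul
        (hy t ht)
      refine h.congr_deriv ?_
      simp only [id]
      ring
    intro t ht
    have h := constant_of_has_deriv_right_zero (a := 0) (b := t)
      (fun u hu => ((hd u hu.1).continuousWithinAt).mono Set.Icc_subset_Ici_self)
      (fun u hu => (hd u hu.1).mono (Set.Ici_subset_Ici.mpr hu.1)) t ⟨ht, le_rfl⟩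
    simp only [mul_zero, Real.exp_zero, one_mul] at h
    rw [← h, ← mul_assoc, ← Real.exp_add]
    simp
  suffices h0 : y 0 = 0 by rw [hexp t ht, h0, mul_zero]
  -- `y 0 * σ` grows at rate `exp (ρ t) * (y 0) ^ 2 ≥ (y 0) ^ 2`.
  have hmono : MonotoneOn (fun t => y 0 * σ t - y 0 ^ 2 * t) (Set.Ici 0) := by
    have hd : ∀ t, 0 ≤ t → HasDerivWithinAt (fun t => y 0 * σ t - y 0 ^ 2 * t)
        (y 0 * y t - y 0 ^ 2 * 1) (Set.Ici 0) t := fun t ht =>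
      ((hσ t ht).const_mul (y 0)).sub ((hasDerivWithinAt_id t _).const_mul (y 0 ^ 2))
    refine monotoneOn_of_hasDerivWithinAt_nonneg (convex_Ici 0)
      (fun t ht => (hd t ht).continuousWithinAt)
      (fun t ht => (hd t (interior_subset ht)).mono interior_subset) (fun t ht => ?_)
    have ht0 : 0 ≤ t := interior_subset ht
    have h1 : 1 ≤ Real.exp (ρ * t) := Real.one_le_exp (mul_nonneg hρ ht0)
    rw [hexp t ht0]
    nlinarith [mul_nonneg (sub_nonneg.mpr h1) (sq_nonneg (y 0))]
  by_contra hne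
  have hK0 : 0 ≤ K := (abs_nonneg _).trans (hK 0 le_rfl)
  have habs : 0 < |y 0| := abs_pos.mpr hne
  -- By time `T` the product `y 0 * σ` has grown by more than the bound `2 * |y 0| * K` allows.
  set T := (2 * K + 1) / |y 0| with hT
  have hT0 : 0 ≤ T := by positivity
  have h := hmono Set.self_mem_Ici hT0 hT0
  have hle : ∀ t, 0 ≤ t → |y 0 * σ t| ≤ |y 0| * K := fun t ht => by
    rw [abs_mul]
    exact mul_le_mul_of_nonneg_left (hK t ht) habs.le
  have hTe : y 0 ^ 2 * T = |y 0| * (2 * K + 1) := by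
    rw [hT, ← sq_abs]
    field_simp
  have h1 := (abs_le.mp (hle 0 le_rfl)).1
  have h2 := (abs_le.mp (hle T hT0)).2
  simp only [mul_zero, sub_zero] at h
  linarith

end MeanFieldLQ

open MeanFieldLQ in
theorem mainTheorem8 {n m : ℕ} (ρ : ℝ) (hρ : 0 ≤ ρ) (B D : Matrix (Fin n) (Fin m) ℝ)
    (R : Matrix (Fin m) (Fin m) ℝ) (hR : R.IsSymm) (P : Matrix (Fin n) (Fin n) ℝ)
    (hP : MeanFieldLQ.IsRiccatiSolution ρ 0 B 0 D 1 R P) (x₀ : Fin n → ℝ) :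
    MeanFieldLQ.IsBoundedIntegratorSolution ρ B D R P x₀
        (fun _ => -(P *ᵥ x₀)) (fun _ => x₀) ∧
      ∀ s x : ℝ → Fin n → ℝ, MeanFieldLQ.IsBoundedIntegratorSolution ρ B D R P x₀ s x →
        ∀ t : ℝ, 0 ≤ t → s t = -(P *ᵥ x₀) ∧ x t = x₀ := by
  obtain ⟨N, hPN, hNP, hA, hAT, hM⟩ := hP.exists_inverse
  -- In terms of `N` the right-hand sides are `x + N s` and `(ρ - N) (x + N s)`.
  have hadj : ∀ s x : Fin n → ℝ,
      ρ • s - (closedLoop 0 B 0 D R P)ᵀ *ᵥ s + (1 : Matrix (Fin n) (Fin n) ℝ) *ᵥ x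
        = x + N *ᵥ s := by
    intro s x
    rw [hAT, Matrix.sub_mulVec, Matrix.smul_mulVec, Matrix.one_mulVec, Matrix.one_mulVec]
    abel
  have hstate : ∀ s x : Fin n → ℝ,
      closedLoop 0 B 0 D R P *ᵥ x - (B * (controlWeight D R P)⁻¹ * Bᵀ) *ᵥ s
        = ρ • (x + N *ᵥ s) - N *ᵥ (x + N *ᵥ s) := by
    intro s x
    rw [hA, hM, ← Matrix.mulVec_mulVec, Matrix.sub_mulVec, Matrix.sub_mulVec,
      Matrix.smul_mulVec, Matrix.smul_mulVec, Matrix.one_mulVec, Matrix.one_mulVec,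
      Matrix.mulVec_add, smul_add]
    abel
  refine ⟨⟨⟨rfl, fun t _ => ?_, fun t _ => ?_⟩, ⟨‖-(P *ᵥ x₀)‖, fun _ _ => le_rfl⟩,
    ⟨‖x₀‖, fun _ _ => le_rfl⟩⟩, ?_⟩
  · rw [hadj, Matrix.mulVec_neg, Matrix.mulVec_mulVec, hNP, Matrix.one_mulVec, add_neg_cancel]
    exact hasDerivWithinAt_const _ _ _
  · rw [hstate, Matrix.mulVec_neg, Matrix.mulVec_mulVec, hNP, Matrix.one_mulVec, add_neg_cancel,
      Matrix.mulVec_zero, smul_zero, sub_zero]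
    exact hasDerivWithinAt_const _ _ _
  rintro s x ⟨⟨hx0, hs, hx⟩, ⟨K, hK⟩, -⟩
  simp only [hadj] at hs
  simp only [hstate] at hx
  have hy : ∀ t, 0 ≤ t → HasDerivWithinAt (fun t => x t + N *ᵥ s t)
      (ρ • (x t + N *ᵥ s t)) (Set.Ici 0) t := by
    intro t ht
    have hNs := (Matrix.mulVecLin N).toContinuousLinearMap.hasFDerivAt.comp_hasDerivWithinAt t
      (hs t ht)
    exact ((hx t ht).add hNs).congr_deriv (sub_add_cancel _ _)
  have hy0 : ∀ t, 0 ≤ t → x t + N *ᵥ s t = 0 := fun t ht => funext fun i =>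
    eq_zero_of_bounded_antiderivative hρ (σ := fun t => s t i)
      (y := fun t => (x t + N *ᵥ s t) i)
      (fun u hu => hasDerivWithinAt_pi.mp (hs u hu) i)
      (fun u hu => hasDerivWithinAt_pi.mp (hy u hu) i)
      (fun u hu => (norm_le_pi_norm (s u) i).trans (hK u hu)) ht
  have hsx : ∀ t, 0 ≤ t → s t = -(P *ᵥ x t) := by
    intro t ht
    rw [eq_neg_of_add_eq_zero_left (hy0 t ht), Matrix.mulVec_neg, Matrix.mulVec_mulVec, hPN,
      Matrix.one_mulVec, neg_neg]
  intro t ht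
  have hs0 : s t = s 0 := by
    have hd : ∀ u, 0 ≤ u → HasDerivWithinAt s 0 (Set.Ici 0) u := fun u hu =>
      (hs u hu).congr_deriv (hy0 u hu)
    exact constant_of_has_deriv_right_zero
      (fun u hu => ((hd u hu.1).continuousWithinAt).mono Set.Icc_subset_Ici_self)
      (fun u hu => (hd u hu.1).mono (Set.Ici_subset_Ici.mpr hu.1)) t ⟨ht, le_rfl⟩
  constructor
  · rw [hs0, hsx 0 le_rfl, hx0]
  · rw [eq_neg_of_add_eq_zero_left (hy0 t ht), hs0,
      ← eq_neg_of_add_eq_zero_left (hy0 0 le_rfl), hx0]
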